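/- Let $\mathcal M$ be a von Neumann algebra acting on a complex Hilbert space $H$, and let $a$ be an injective positive self-adjoint operator affiliated with $\mathcal M$ such that both $a$ and $a^{-1}$ are unbounded. Let $a=\int_0^{+\infty}\lambda\,dP_\lambda$ be its spectral decomposition and put $a_0=\int_{[0,1]}\lambda\,dP_\lambda$, $a_\infty=\int_{(1,\infty)}\lambda\,dP_\lambda$. For $\alpha,\beta>0$ let $\mathcal S^{\alpha,\beta}_{0,\infty}$ be the linear space of the sesquilinear forms $$\widehat{a_0^\alpha x a_\infty^\beta}(f,g)=\langle x\,a_\infty^\beta f,\ a_0^\alpha g\rangle ,\qquad x\in\mathcal M,$$ on $D(a_\infty^\beta)\times D(a_0^\alpha)$, with the norm $\|u\|_{a_0^\alpha,a_\infty^\beta}=\inf\{\|x\| : x\in\mathcal M,\ \widehat{a_0^\alpha x a_\infty^\beta}=u\}$ (that is, $\|x\|$ if $x$ is taken in the corner $p_0\mathcal M p_\infty$, where $p_0=P([0,1])$, $p_\infty=P((1,\infty))$). Forms for different exponents are compared by restriction to the common domain $\bigcap_{\beta>0} D(a_\infty^\beta)\times\bigcap_{\alpha>0}D(a_0^\alpha)$,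 on which each of them is determined; in this sense $\mathcal S^{\alpha,\beta_1}_{0,\infty}\subset\mathcal S^{\alpha,\beta_2}_{0,\infty}$ for $\beta_1\le\beta_2$. Let $$\mathfrak S_0^\alpha=\bigcup_{\beta>0}\mathcal S^{\alpha,\beta}_{0,\infty},\qquad \mathfrak S_\infty^\beta=\bigcap_{\alpha>0}\mathcal S^{\alpha,\beta}_{0,\infty},$$ where $\mathfrak S_0^\alpha$ has the strongest topology $\tau_0^\alpha$ for which all embeddings $\mathcal S^{\alpha,\beta}_{0,\infty}\to\mathfrak S_0^\alpha$ ($\beta>0$) are continuous, and $\mathfrak S_\infty^\beta$ has the weakest topology $\tau_\infty^\beta$ for which all embeddings $\mathfrak S_\infty^\beta\to\mathcal S^{\alpha,\beta}_{0,\infty}$ ($\alpha>0$) are continuous. Let $$\underline{\mathfrak L_{0,\infty}}=\bigcup_{\beta>0}\mathfrak S_\infty^\beta,\qquad \overline{\mathfrak L_{0,\infty}}=\bigcap_{\alpha>0}\mathfrak S_0^\alpha,$$ let $\overline{\tau_{0,\infty}}$ be the strongest topology on $\underline{\mathfrak L_{0,\infty}}$ for which all embeddings $(\mathfrak S_\infty^\beta,\tau_\infty^\beta)\to\underline{\mathfrak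 L_{0,\infty}}$ are continuous, and let $\underline{\tau_{0,\infty}}$ be the weakest topology on $\overline{\mathfrak L_{0,\infty}}$ for which all embeddings $\overline{\mathfrak L_{0,\infty}}\to(\mathfrak S_0^\alpha,\tau_0^\alpha)$ are continuous. Then $\underline{\mathfrak L_{0,\infty}}\subset\overline{\mathfrak L_{0,\infty}}$ and the embedding $$\Lambda:(\underline{\mathfrak L_{0,\infty}},\overline{\tau_{0,\infty}})\to(\overline{\mathfrak L_{0,\infty}},\underline{\tau_{0,\infty}}),\qquad x\mapsto x,$$ is continuous. This holds both when "strongest topology" (for $\tau_0^\alpha$ and $\overline{\tau_{0,\infty}}$) means strongest among all topologies and when it means strongest among all locally convex vector space topologies. -/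

import Mathlib

open MeasureTheory Filter Topology
open scoped NNReal ENNReal ComplexConjugate

/-- A projection-valued (spectral) measure on the measurable space `X`, acting on `H`. -/
structure ProjMeasure (X : Type*) [MeasurableSpace X] (H : Type*) [NormedAddCommGroup H]
    [InnerProductSpace ℂ H] [CompleteSpace H] where
  proj : Set X → H →L[ℂ] H
  isStarProjection : ∀ s, MeasurableSet s → IsStarProjection (proj s)
  proj_univ : proj Set.univ = 1
  proj_inter : ∀ s t, MeasurableSet s → MeasurableSet t → proj (s ∩ t) = proj s * proj t
  hasSum_iUnion : ∀ s : ℕ → Set X, (∀ n, MeasurableSet (s n)) →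
    Pairwise (Function.onFun Disjoint s) →
    ∀ f : H, HasSum (fun n => proj (s n) f) (proj (⋃ n, s n) f)

namespace ProjMeasure

variable {X : Type*} [MeasurableSpace X] {H : Type*} [NormedAddCommGroup H]
  [InnerProductSpace ℂ H] [CompleteSpace H]

theorem proj_empty (P : ProjMeasure X H) : P.proj ∅ = 0 := by
  ext f
  have h := P.hasSum_iUnion (fun _ => ∅) (fun _ => MeasurableSet.empty)
    (fun _ _ _ => disjoint_bot_left) f
  simpa using (tendsto_nhds_unique h.summable.tendsto_atTop_zero tendsto_const_nhds).symm

theorem inner_proj (P : ProjMeasure X H) {s : Set X} (hs : MeasurableSet s) (f g : H) :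
    inner ℂ (P.proj s f) g = inner ℂ f (P.proj s g) := by
  have h := (P.isStarProjection s hs).isSelfAdjoint.star_eq
  rw [← ContinuousLinearMap.adjoint_inner_right, ← ContinuousLinearMap.star_eq_adjoint, h]

theorem inner_proj_proj (P : ProjMeasure X H) {s t : Set X} (hs : MeasurableSet s)
    (ht : MeasurableSet t) (f g : H) :
    inner ℂ (P.proj s f) (P.proj t g) = inner ℂ f (P.proj (s ∩ t) g) := by
  rw [P.inner_proj hs, P.proj_inter s t hs ht]; rfl

theorem norm_sq_proj (P : ProjMeasure X H) {s : Set X} (hs : MeasurableSet s) (f : H) :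
    ‖P.proj s f‖ ^ 2 = RCLike.re (inner ℂ f (P.proj s f)) := by
  rw [← inner_self_eq_norm_sq (𝕜 := ℂ), P.inner_proj_proj hs hs, Set.inter_self]

/-- The scalar spectral measure `s ↦ ‖P(s) f‖² = ⟨P(s) f, f⟩` of the vector `f`. -/
noncomputable def scalar (P : ProjMeasure X H) (f : H) : Measure X :=
  Measure.ofMeasurable (fun s _ => ENNReal.ofReal (‖P.proj s f‖ ^ 2)) (by simp [P.proj_empty])
    (by
      intro s hs hd
      have h1 : HasSum (fun n => ‖P.proj (s n) f‖ ^ 2) (‖P.proj (⋃ n, s n) f‖ ^ 2) := by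
        simp_rw [P.norm_sq_proj (hs _), P.norm_sq_proj (MeasurableSet.iUnion hs)]
        exact RCLike.hasSum_re ℂ ((innerSL ℂ f).hasSum (P.hasSum_iUnion s hs hd f))
      rw [← h1.tsum_eq, ENNReal.ofReal_tsum_of_nonneg (fun _ => by positivity) h1.summable])

theorem scalar_apply (P : ProjMeasure X H) (f : H) {s : Set X} (hs : MeasurableSet s) :
    P.scalar f s = ENNReal.ofReal (‖P.proj s f‖ ^ 2) :=
  Measure.ofMeasurable_apply s hs

instance (P : ProjMeasure X H) (f : H) : IsFiniteMeasure (P.scalar f) :=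
  ⟨by rw [P.scalar_apply f MeasurableSet.univ]; exact ENNReal.ofReal_lt_top⟩

theorem scalar_add_le (P : ProjMeasure X H) (f g : H) :
    P.scalar (f + g) ≤ (2 : ℝ≥0∞) • (P.scalar f + P.scalar g) := by
  refine Measure.le_iff.2 fun s hs => ?_
  simp only [Measure.smul_apply, Measure.add_apply, P.scalar_apply _ hs, smul_eq_mul]
  rw [← ENNReal.ofReal_add (by positivity) (by positivity),
    show (2 : ℝ≥0∞) = ENNReal.ofReal 2 by simp, ← ENNReal.ofReal_mul (by norm_num), map_add]
  refine ENNReal.ofReal_le_ofReal ?_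
  have := norm_add_le (P.proj s f) (P.proj s g)
  nlinarith [sq_nonneg (‖P.proj s f‖ - ‖P.proj s g‖), norm_nonneg (P.proj s f + P.proj s g)]

theorem scalar_smul (P : ProjMeasure X H) (c : ℂ) (f : H) :
    P.scalar (c • f) = ENNReal.ofReal (‖c‖ ^ 2) • P.scalar f := by
  ext s hs
  simp only [Measure.smul_apply, P.scalar_apply _ hs, smul_eq_mul]
  rw [← ENNReal.ofReal_mul (by positivity), map_smul, norm_smul, mul_pow]

theorem proj_union (P : ProjMeasure X H) {s t : Set X} (hs : MeasurableSet s)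
    (ht : MeasurableSet t) (hd : Disjoint s t) : P.proj (s ∪ t) = P.proj s + P.proj t := by
  ext f
  let u : ℕ → Set X := fun n => if n = 0 then s else if n = 1 then t else ∅
  have hu : ⋃ n, u n = s ∪ t := by
    ext x
    simp only [Set.mem_iUnion, Set.mem_union, u]
    constructor
    · rintro ⟨n, hn⟩
      split_ifs at hn <;> simp_all
    · rintro (h | h)
      · exact ⟨0, by simpa using h⟩
      · exact ⟨1, by simpa using h⟩
  have hm : ∀ n, MeasurableSet (u n) := fun n => by
    simp only [u]; split_ifs <;> simp [hs, ht]
  have hp : Pairwise (Function.onFun Disjoint u) := by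
    intro i j hij
    simp only [Function.onFun, u]
    split_ifs <;> simp_all [disjoint_comm]
  have h := P.hasSum_iUnion u hm hp f
  rw [hu] at h
  refine h.unique ?_
  have h2 : HasSum (fun n => P.proj (u n) f) (∑ n ∈ Finset.range 2, P.proj (u n) f) := by
    refine hasSum_sum_of_ne_finset_zero fun n hn => ?_
    have : u n = ∅ := by
      simp only [Finset.mem_range, not_lt] at hn
      simp only [u]; rw [if_neg (by omega), if_neg (by omega)]
    rw [this, P.proj_empty]; rfl
  simpa [Finset.sum_range_succ, u] using h2

/-- The integral `∑ y, y P({s = y})` of a real simple function `s`. -/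
noncomputable def simpleIntegral (P : ProjMeasure X H) (s : SimpleFunc X ℝ) : H →L[ℂ] H :=
  ∑ y ∈ s.range, y • P.proj (s ⁻¹' {y})

theorem simpleIntegral_sub (P : ProjMeasure X H) (s t : SimpleFunc X ℝ) :
    P.simpleIntegral (s - t) = P.simpleIntegral s - P.simpleIntegral t :=
  SimpleFunc.setToSimpleFunc_sub (μ := 0)
    (fun u => ContinuousLinearMap.toSpanSingleton ℝ (P.proj u))
    (fun u v hu hv _ _ hd => by ext; simp [P.proj_union hu hv hd])
    (SimpleFunc.integrable_of_isFiniteMeasure s) (SimpleFunc.integrable_of_isFiniteMeasure t)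

theorem enorm_sq_simpleIntegral (P : ProjMeasure X H) (s : SimpleFunc X ℝ) (f : H) :
    ‖P.simpleIntegral s f‖ₑ ^ 2 = ∫⁻ x, ‖s x‖ₑ ^ 2 ∂(P.scalar f) := by
  have h1 : ‖P.simpleIntegral s f‖ ^ 2
      = ∑ y ∈ s.range, ‖y‖ ^ 2 * ‖P.proj (s ⁻¹' {y}) f‖ ^ 2 := by
    rw [← inner_self_eq_norm_sq (𝕜 := ℂ)]
    simp only [simpleIntegral, sum_apply, smul_apply]
    rw [sum_inner, map_sum]
    refine Finset.sum_congr rfl fun y hy => ?_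
    rw [inner_sum, Finset.sum_eq_single y]
    · rw [inner_self_eq_norm_sq, norm_smul, mul_pow]
    · intro z _ hzy
      have : s ⁻¹' {y} ∩ s ⁻¹' {z} = ∅ := by
        rw [← Set.preimage_inter, Set.singleton_inter_eq_empty.2 (by simpa using hzy.symm),
          Set.preimage_empty]
      simp only [← Complex.coe_smul, inner_smul_left, inner_smul_right]
      rw [P.inner_proj_proj (s.measurableSet_fiber y) (s.measurableSet_fiber z), this,
        P.proj_empty]
      simp
    · exact fun h => absurd hy h
  have h2 := SimpleFunc.lintegral_eq_lintegral (s.map fun y => ‖y‖ₑ ^ 2) (P.scalar f)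
  simp only [SimpleFunc.coe_map, Function.comp_apply] at h2
  rw [h2, SimpleFunc.map_lintegral, ← ofReal_norm (P.simpleIntegral s f),
    ← ENNReal.ofReal_pow (norm_nonneg _), h1, ENNReal.ofReal_sum_of_nonneg (by intros; positivity)]
  refine Finset.sum_congr rfl fun y _ => ?_
  rw [P.scalar_apply _ (s.measurableSet_fiber y), ENNReal.ofReal_mul (by positivity),
    ← ofReal_norm, ENNReal.ofReal_pow (norm_nonneg y)]

theorem enorm_simpleIntegral (P : ProjMeasure X H) (s : SimpleFunc X ℝ) (f : H) :
    ‖P.simpleIntegral s f‖ₑ = eLpNorm s 2 (P.scalar f) := by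
  rw [eLpNorm_eq_lintegral_rpow_enorm_toReal (by norm_num) (by norm_num)]
  simp only [ENNReal.toReal_ofNat, ENNReal.rpow_ofNat]
  rw [← enorm_sq_simpleIntegral, ← ENNReal.rpow_natCast, ← ENNReal.rpow_mul]
  norm_num

/-- The simple functions used to approximate `φ`. -/
noncomputable def approx (φ : X → ℝ) (hφ : Measurable φ) (n : ℕ) : SimpleFunc X ℝ :=
  SimpleFunc.approxOn φ hφ Set.univ 0 (Set.mem_univ 0) n

theorem tendsto_approx {φ : X → ℝ} (hφ : Measurable φ) {μ : Measure X} (h : MemLp φ 2 μ) :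
    Tendsto (fun n => eLpNorm (⇑(approx φ hφ n) - φ) 2 μ) atTop (𝓝 0) :=
  SimpleFunc.tendsto_approxOn_Lp_eLpNorm hφ (Set.mem_univ 0) (by norm_num) (by simp)
    (by simpa using h.eLpNorm_lt_top)

theorem exists_tendsto (P : ProjMeasure X H) {φ : X → ℝ} (hφ : Measurable φ) {f : H}
    (h : MemLp φ 2 (P.scalar f)) :
    ∃ k, Tendsto (fun n => P.simpleIntegral (approx φ hφ n) f) atTop (𝓝 k) := by
  refine cauchySeq_tendsto_of_complete ?_
  rw [EMetric.cauchySeq_iff]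
  intro ε hε
  have h0 := (tendsto_approx hφ h).eventually (gt_mem_nhds (ENNReal.half_pos hε.ne'))
  obtain ⟨N, hN⟩ := eventually_atTop.1 h0
  refine ⟨N, fun m hm n hn => ?_⟩
  rw [edist_eq_enorm_sub, ← sub_apply, ← simpleIntegral_sub,
    enorm_simpleIntegral, SimpleFunc.coe_sub]
  have e : (⇑(approx φ hφ m) - ⇑(approx φ hφ n) : X → ℝ)
      = (⇑(approx φ hφ m) - φ) - (⇑(approx φ hφ n) - φ) := by abel
  rw [e]
  have hm' (n) : AEStronglyMeasurable (⇑(approx φ hφ n) - φ) (P.scalar f) :=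
    ((approx φ hφ n).measurable.sub hφ).aestronglyMeasurable
  refine (eLpNorm_sub_le (hm' m) (hm' n) (by norm_num)).trans_lt ?_
  rw [← ENNReal.add_halves ε]
  exact ENNReal.add_lt_add (hN m hm) (hN n hn)

theorem memLp_iff {φ : X → ℝ} (hφ : Measurable φ) (μ : Measure X) :
    MemLp φ 2 μ ↔ ∫⁻ x, ‖φ x‖ₑ ^ 2 ∂μ < ∞ := by
  rw [MemLp, and_iff_right hφ.aestronglyMeasurable,
    eLpNorm_lt_top_iff_lintegral_rpow_enorm_lt_top (by norm_num) (by norm_num)]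
  simp

/-- The operator `∫ φ dP` for a real measurable function `φ`. Its domain is
`{f | ∫ |φ|² dμ_f < ∞}`, where `μ_f(s) = ‖P(s) f‖²`, and it is the strong limit there of the
integrals of simple functions that converge to `φ` (dominated by `2|φ|`). -/
noncomputable def integral (P : ProjMeasure X H) (φ : X → ℝ) (hφ : Measurable φ) :
    H →ₗ.[ℂ] H where
  domain :=
    { carrier := {f | ∫⁻ x, ‖φ x‖ₑ ^ 2 ∂(P.scalar f) < ∞}
      zero_mem' := by
        have : P.scalar 0 = 0 := by ext s hs; simp [P.scalar_apply _ hs]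
        simp [this]
      add_mem' := fun {f g} hf hg => by
        refine (lintegral_mono' (P.scalar_add_le f g) le_rfl).trans_lt ?_
        rw [lintegral_smul_measure, lintegral_add_measure]
        exact ENNReal.mul_lt_top (by norm_num) (ENNReal.add_lt_top.2 ⟨hf, hg⟩)
      smul_mem' := fun c f hf => by
        simp only [Set.mem_ofPred_eq, P.scalar_smul, lintegral_smul_measure]
        exact ENNReal.mul_lt_top ENNReal.ofReal_lt_top hf }
  toFun :=
    { toFun := fun f => limUnder atTop fun n => P.simpleIntegral (approx φ hφ n) f
      map_add' := fun f g => by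
        have h1 := tendsto_nhds_limUnder (P.exists_tendsto hφ ((memLp_iff hφ _).2 f.2))
        have h2 := tendsto_nhds_limUnder (P.exists_tendsto hφ ((memLp_iff hφ _).2 g.2))
        refine Tendsto.limUnder_eq ?_
        simpa using h1.add h2
      map_smul' := fun c f => by
        have h1 := tendsto_nhds_limUnder (P.exists_tendsto hφ ((memLp_iff hφ _).2 f.2))
        refine Tendsto.limUnder_eq ?_
        simpa using h1.const_smul c }

theorem mem_domain_iff (P : ProjMeasure X H) {φ : X → ℝ} (hφ : Measurable φ) (f : H) :
    f ∈ (P.integral φ hφ).domain ↔ ∫⁻ x, ‖φ x‖ₑ ^ 2 ∂(P.scalar f) < ∞ := Iff.rfl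

theorem tendsto_integral (P : ProjMeasure X H) {φ : X → ℝ} (hφ : Measurable φ)
    (f : (P.integral φ hφ).domain) :
    Tendsto (fun n => P.simpleIntegral (approx φ hφ n) f) atTop (𝓝 (P.integral φ hφ f)) :=
  tendsto_nhds_limUnder (P.exists_tendsto hφ ((memLp_iff hφ _).2 f.2))

theorem norm_approx_le {φ : X → ℝ} (hφ : Measurable φ) (n : ℕ) (x : X) :
    ‖approx φ hφ n x‖ ≤ 2 * ‖φ x‖ := by
  rw [two_mul]; exact SimpleFunc.norm_approxOn_zero_le hφ (Set.mem_univ 0) x n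

theorem tendsto_approx_apply {φ : X → ℝ} (hφ : Measurable φ) (x : X) :
    Tendsto (fun n => approx φ hφ n x) atTop (𝓝 (φ x)) :=
  SimpleFunc.tendsto_approxOn hφ (Set.mem_univ 0) (by simp)

/-- Dominated convergence for spectral integrals. -/
theorem tendsto_integral_of_dominated (P : ProjMeasure X H) {φ : X → ℝ} (hφ : Measurable φ)
    (f : (P.integral φ hφ).domain) (s : ℕ → SimpleFunc X ℝ) {g : X → ℝ}
    (hg : ∫⁻ x, ‖g x‖ₑ ^ 2 ∂(P.scalar f) < ∞) (hs : ∀ n x, ‖s n x‖ ≤ g x)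
    (hlim : ∀ x, Tendsto (fun n => s n x) atTop (𝓝 (φ x))) :
    Tendsto (fun n => P.simpleIntegral (s n) f) atTop (𝓝 (P.integral φ hφ f)) := by
  have hφg : ∀ x, ‖φ x‖ ≤ g x := fun x =>
    le_of_tendsto (hlim x).norm (Eventually.of_forall fun n => hs n x)
  have h0 : Tendsto (fun n => ∫⁻ x, ‖(s n - approx φ hφ n) x‖ₑ ^ 2 ∂(P.scalar f)) atTop
      (𝓝 (∫⁻ _, 0 ∂(P.scalar f))) := by
    refine tendsto_lintegral_of_dominated_convergence (fun x => ‖3 * g x‖ₑ ^ 2)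
      (fun n => ((s n - approx φ hφ n).measurable.enorm.pow_const 2)) (fun n => ?_) ?_ ?_
    · refine Eventually.of_forall fun x => ?_
      refine pow_le_pow_left' (enorm_le_iff_norm_le.2 ?_) 2
      rw [SimpleFunc.sub_apply]
      have h1 := norm_sub_le (s n x) (approx φ hφ n x)
      have h2 := norm_approx_le hφ n x
      have h3 := hs n x
      have h4 := hφg x
      have h5 := le_abs_self (g x)
      rw [norm_mul, Real.norm_ofNat, Real.norm_eq_abs (g x)]
      linarith
    · simp only [enorm_mul, mul_pow]
      rw [lintegral_const_mul' _ _ (by simp)]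
      exact (ENNReal.mul_lt_top (by simp) hg).ne
    · refine Eventually.of_forall fun x => ?_
      have h1 := (hlim x).sub (tendsto_approx_apply hφ x)
      rw [sub_self] at h1
      simpa using ENNReal.Tendsto.pow (n := 2) h1.enorm
  simp only [← enorm_sq_simpleIntegral, lintegral_zero] at h0
  have h1 : Tendsto (fun n => P.simpleIntegral (s n - approx φ hφ n) (f : H)) atTop (𝓝 0) := by
    rw [tendsto_zero_iff_norm_tendsto_zero]
    have h2 := (ENNReal.tendsto_toReal ENNReal.zero_ne_top).comp h0
    simp only [Function.comp_def, ENNReal.toReal_pow, toReal_enorm, ENNReal.toReal_zero] at h2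
    have h3 := h2.sqrt
    simpa [Real.sqrt_sq] using h3
  have h2 := h1.add (P.tendsto_integral hφ f)
  simpa [simpleIntegral_sub] using h2

theorem simpleIntegral_mul (P : ProjMeasure X H) (s t : SimpleFunc X ℝ) :
    P.simpleIntegral (s * t) = P.simpleIntegral s * P.simpleIntegral t := by
  have h1 : P.simpleIntegral (s * t)
      = ∑ p ∈ (s.pair t).range, (p.1 * p.2) • P.proj (s.pair t ⁻¹' {p}) :=
    SimpleFunc.map_setToSimpleFunc (μ := 0)
      (fun u => ContinuousLinearMap.toSpanSingleton ℝ (P.proj u))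
      (fun u v hu hv _ _ hd => by ext; simp [P.proj_union hu hv hd])
      (f := s.pair t) (g := fun p : ℝ × ℝ => p.1 * p.2)
      (SimpleFunc.integrable_of_isFiniteMeasure _) (by simp)
  have h2 : (s.pair t).range ⊆ s.range ×ˢ t.range := fun p hp => by
    obtain ⟨x, rfl⟩ := SimpleFunc.mem_range.1 hp
    exact Finset.mem_product.2 ⟨SimpleFunc.mem_range_self s x, SimpleFunc.mem_range_self t x⟩
  rw [h1, Finset.sum_subset h2, Finset.sum_product, simpleIntegral, simpleIntegral,
    Finset.sum_mul_sum]
  · refine Finset.sum_congr rfl fun y _ => Finset.sum_congr rfl fun z _ => ?_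
    rw [smul_mul_smul_comm, ← P.proj_inter _ _ (s.measurableSet_fiber y) (t.measurableSet_fiber z)]
    congr 2
    ext x; simp
  · intro p _ hp
    rw [SimpleFunc.preimage_eq_empty_iff _ _ |>.2 hp, P.proj_empty, smul_zero]

theorem norm_simpleIntegral_le (P : ProjMeasure X H) (s : SimpleFunc X ℝ) {C : ℝ} (hC : 0 ≤ C)
    (hs : ∀ x, ‖s x‖ ≤ C) (f : H) : ‖P.simpleIntegral s f‖ ≤ C * ‖f‖ := by
  have h1 : ‖P.simpleIntegral s f‖ₑ ^ 2 ≤ (‖C‖ₑ * ‖f‖ₑ) ^ 2 := by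
    rw [enorm_sq_simpleIntegral]
    calc _ ≤ ∫⁻ _, ‖C‖ₑ ^ 2 ∂(P.scalar f) := lintegral_mono fun x =>
            pow_le_pow_left' (enorm_le_iff_norm_le.2 (by rw [Real.norm_of_nonneg hC]; exact hs x)) 2
      _ = _ := by
        rw [lintegral_const, P.scalar_apply f MeasurableSet.univ, P.proj_univ, mul_pow,
          ENNReal.ofReal_pow (norm_nonneg _), ofReal_norm]; rfl
  have h2 := (ENNReal.pow_le_pow_left_iff two_ne_zero).1 h1
  rw [← enorm_norm f, ← enorm_mul, enorm_le_iff_norm_le, norm_mul, norm_norm,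
    Real.norm_of_nonneg hC] at h2
  exact h2

/-- The bounded operator `∫ ψ dP`, for `|ψ| ≤ 1`, as an element of `B(H)`. -/
theorem exists_bounded (P : ProjMeasure X H) {ψ : X → ℝ} (hψ : Measurable ψ)
    (h1 : ∀ x, ‖ψ x‖ ≤ 1) : ∃ c : H →L[ℂ] H,
      ∀ f, Tendsto (fun n => P.simpleIntegral (approx ψ hψ n) f) atTop (𝓝 (c f)) := by
  have hd : ∀ f, f ∈ (P.integral ψ hψ).domain := fun f => by
    rw [mem_domain_iff]
    refine (lintegral_mono (g := fun _ => 1) fun x => ?_).trans_lt (by simp)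
    refine pow_le_one' ?_ 2
    simpa using (enorm_le_iff_norm_le (y := (1 : ℝ))).2 (by simpa using h1 x)
  let c₀ : H →ₗ[ℂ] H :=
    { toFun := fun f => P.integral ψ hψ ⟨f, hd f⟩
      map_add' := fun f g => (P.integral ψ hψ).map_add ⟨f, hd f⟩ ⟨g, hd g⟩
      map_smul' := fun c f => (P.integral ψ hψ).map_smul c ⟨f, hd f⟩ }
  refine ⟨c₀.mkContinuous 2 fun f => ?_, fun f => P.tendsto_integral hψ ⟨f, hd f⟩⟩
  refine le_of_tendsto (P.tendsto_integral hψ ⟨f, hd f⟩).norm (Eventually.of_forall fun n => ?_)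
  refine P.norm_simpleIntegral_le _ (by norm_num) (fun x => ?_) f
  have := norm_approx_le hψ n x
  linarith [h1 x]

/-- `(∫ ψ dP)(∫ φ dP) ⊆ ∫ ψφ dP` for `|ψ| ≤ 1`. -/
theorem bounded_mul (P : ProjMeasure X H) {ψ φ θ : X → ℝ} (hψ : Measurable ψ) (hφ : Measurable φ)
    (hθ : Measurable θ) (h1 : ∀ x, ‖ψ x‖ ≤ 1) (h : ∀ x, θ x = ψ x * φ x) {c : H →L[ℂ] H}
    (hc : ∀ f, Tendsto (fun n => P.simpleIntegral (approx ψ hψ n) f) atTop (𝓝 (c f)))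
    {f : H} (hf : f ∈ (P.integral φ hφ).domain) (hf' : f ∈ (P.integral θ hθ).domain) :
    c (P.integral φ hφ ⟨f, hf⟩) = P.integral θ hθ ⟨f, hf'⟩ := by
  have hb : ∀ n x, ‖approx ψ hψ n x‖ ≤ 2 := fun n x => by
    have := norm_approx_le hψ n x
    linarith [h1 x]
  have t1 : Tendsto (fun n => P.simpleIntegral (approx ψ hψ n * approx φ hφ n) f) atTop
      (𝓝 (P.integral θ hθ ⟨f, hf'⟩)) := by
    refine P.tendsto_integral_of_dominated hθ ⟨f, hf'⟩ _ (g := fun x => 4 * ‖φ x‖) ?_ ?_ ?_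
    · simp only [enorm_mul, mul_pow, enorm_norm]
      rw [lintegral_const_mul' _ _ (by simp)]
      exact ENNReal.mul_lt_top (by simp) hf
    · intro n x
      rw [SimpleFunc.mul_apply, norm_mul]
      have h2 := norm_approx_le hφ n x
      nlinarith [hb n x, norm_nonneg (approx φ hφ n x), norm_nonneg (approx ψ hψ n x)]
    · intro x
      rw [h x]
      exact (tendsto_approx_apply hψ x).mul (tendsto_approx_apply hφ x)
  have t2 := hc (P.integral φ hφ ⟨f, hf⟩)
  have t3 : Tendsto (fun n => P.simpleIntegral (approx ψ hψ n)
      (P.simpleIntegral (approx φ hφ n) f - P.integral φ hφ ⟨f, hf⟩)) atTop (𝓝 0) := by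
    have t4 := ((P.tendsto_integral hφ ⟨f, hf⟩).sub_const (P.integral φ hφ ⟨f, hf⟩)).norm.const_mul 2
    rw [sub_self, norm_zero, mul_zero] at t4
    exact squeeze_zero_norm (fun n => P.norm_simpleIntegral_le _ (by norm_num) (hb n) _) t4
  have t5 := t3.add t2
  simp only [map_sub, sub_add_cancel, zero_add] at t5
  refine tendsto_nhds_unique t5 ?_
  simpa [simpleIntegral_mul] using t1

theorem enorm_sq_integral (P : ProjMeasure X H) {φ : X → ℝ} (hφ : Measurable φ)
    (f : (P.integral φ hφ).domain) :
    ‖P.integral φ hφ f‖ₑ ^ 2 = ∫⁻ x, ‖φ x‖ₑ ^ 2 ∂(P.scalar f) := by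
  have h1 := ENNReal.Tendsto.pow (n := 2) (P.tendsto_integral hφ f).enorm
  simp only [enorm_sq_simpleIntegral] at h1
  refine tendsto_nhds_unique h1 ?_
  refine tendsto_lintegral_of_dominated_convergence (fun x => ‖2 * φ x‖ₑ ^ 2)
    (fun n => (approx φ hφ n).measurable.enorm.pow_const 2) (fun n => ?_) ?_ ?_
  · refine Eventually.of_forall fun x => pow_le_pow_left' (enorm_le_iff_norm_le.2 ?_) 2
    simpa using norm_approx_le hφ n x
  · simp only [enorm_mul, mul_pow]
    rw [lintegral_const_mul' _ _ (by simp)]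
    exact (ENNReal.mul_lt_top (by simp) f.2).ne
  · exact Eventually.of_forall fun x =>
      ENNReal.Tendsto.pow (n := 2) (tendsto_approx_apply hφ x).enorm

theorem scalar_proj (P : ProjMeasure X H) {A : Set X} (hA : MeasurableSet A) (f : H) :
    P.scalar (P.proj A f) = (P.scalar f).restrict A := by
  ext s hs
  rw [Measure.restrict_apply hs, P.scalar_apply _ hs, P.scalar_apply _ (hs.inter hA),
    P.proj_inter s A hs hA]; rfl

theorem proj_comm_simple (P : ProjMeasure X H) {A : Set X} (hA : MeasurableSet A)
    (s : SimpleFunc X ℝ) : P.proj A * P.simpleIntegral s = P.simpleIntegral s * P.proj A := by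
  simp only [simpleIntegral, Finset.mul_sum, Finset.sum_mul, smul_mul_assoc, mul_smul_comm]
  refine Finset.sum_congr rfl fun y _ => ?_
  rw [← P.proj_inter _ _ hA (s.measurableSet_fiber y), Set.inter_comm,
    P.proj_inter _ _ (s.measurableSet_fiber y) hA]

theorem proj_mem_domain (P : ProjMeasure X H) {φ : X → ℝ} (hφ : Measurable φ) {A : Set X}
    (hA : MeasurableSet A) {f : H} (hf : f ∈ (P.integral φ hφ).domain) :
    P.proj A f ∈ (P.integral φ hφ).domain := by
  rw [mem_domain_iff, P.scalar_proj hA]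
  exact (lintegral_mono' Measure.restrict_le_self le_rfl).trans_lt hf

theorem integral_proj (P : ProjMeasure X H) {φ : X → ℝ} (hφ : Measurable φ) {A : Set X}
    (hA : MeasurableSet A) {f : H} (hf : f ∈ (P.integral φ hφ).domain) :
    P.integral φ hφ ⟨P.proj A f, P.proj_mem_domain hφ hA hf⟩
      = P.proj A (P.integral φ hφ ⟨f, hf⟩) := by
  refine tendsto_nhds_unique (P.tendsto_integral hφ ⟨P.proj A f, P.proj_mem_domain hφ hA hf⟩) ?_
  have h := ((P.proj A).continuous.tendsto _).comp (P.tendsto_integral hφ ⟨f, hf⟩)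
  refine h.congr fun n => ?_
  have := congrArg (fun T : H →L[ℂ] H => T f) (P.proj_comm_simple hA (approx φ hφ n))
  simpa using this

end ProjMeasure

section Affiliated

variable {H : Type*} [NormedAddCommGroup H] [InnerProductSpace ℂ H] [CompleteSpace H]

/-- A (possibly unbounded) operator is affiliated with `M` if it commutes with every element of
the commutant of `M`, i.e. `y a ⊆ a y` for all `y ∈ M'`. -/
def IsAffiliated (M : VonNeumannAlgebra H) (a : H →ₗ.[ℂ] H) : Prop :=
  ∀ y ∈ M.commutant, ∀ f : a.domain, ∃ h : y f ∈ a.domain, a ⟨y f, h⟩ = y (a f)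

theorem mem_of_commute (M : VonNeumannAlgebra H) {z : H →L[ℂ] H}
    (h : ∀ y ∈ M.commutant, ∀ f, y (z f) = z (y f)) : z ∈ M := by
  rw [← M.commutant_commutant, VonNeumannAlgebra.mem_commutant_iff]
  intro y hy
  ext f
  exact h y hy f

theorem commute_of_mem (M : VonNeumannAlgebra H) {z : H →L[ℂ] H} (hz : z ∈ M) :
    ∀ y ∈ M.commutant, ∀ f, y (z f) = z (y f) := by
  intro y hy f
  have := VonNeumannAlgebra.mem_commutant_iff.1 hy z hz
  exact (congrArg (fun T : H →L[ℂ] H => T f) this).symm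

namespace ProjMeasure

theorem measurable_coe : Measurable (fun t : ℝ≥0 => (t : ℝ)) := by fun_prop

theorem mem_domain_of_Iic (P : ProjMeasure ℝ≥0 H) (m : ℝ≥0) {f : H}
    (hf : P.proj (Set.Iic m) f = f) : f ∈ (P.integral _ measurable_coe).domain ∧
      ∀ h : f ∈ (P.integral _ measurable_coe).domain,
        ‖P.integral _ measurable_coe ⟨f, h⟩‖ ≤ m * ‖f‖ := by
  have h1 : ∫⁻ x, ‖(x : ℝ)‖ₑ ^ 2 ∂(P.scalar f) ≤ (‖(m : ℝ)‖ₑ * ‖f‖ₑ) ^ 2 := by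
    conv_lhs => rw [← hf, P.scalar_proj measurableSet_Iic]
    calc _ ≤ ∫⁻ _ in Set.Iic m, ‖(m : ℝ)‖ₑ ^ 2 ∂(P.scalar f) := by
          refine setLIntegral_mono measurable_const fun x hx => pow_le_pow_left' ?_ 2
          exact enorm_le_iff_norm_le.2 (by simpa using hx)
      _ ≤ ∫⁻ _, ‖(m : ℝ)‖ₑ ^ 2 ∂(P.scalar f) :=
          lintegral_mono' Measure.restrict_le_self le_rfl
      _ = _ := by
        rw [lintegral_const, P.scalar_apply f MeasurableSet.univ, P.proj_univ, mul_pow,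
          ENNReal.ofReal_pow (norm_nonneg _), ofReal_norm]; rfl
  refine ⟨h1.trans_lt (by simp [ENNReal.mul_lt_top]), fun h => ?_⟩
  rw [← P.enorm_sq_integral measurable_coe ⟨f, h⟩] at h1
  have h2 := (ENNReal.pow_le_pow_left_iff two_ne_zero).1 h1
  rw [← enorm_norm f, ← enorm_mul, enorm_le_iff_norm_le] at h2
  simpa using h2

theorem le_norm_of_Ici (P : ProjMeasure ℝ≥0 H) (t : ℝ≥0) {f : H}
    (hf : P.proj (Set.Ici t) f = f) (h : f ∈ (P.integral _ measurable_coe).domain) :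
    t * ‖f‖ ≤ ‖P.integral _ measurable_coe ⟨f, h⟩‖ := by
  have h1 : (‖(t : ℝ)‖ₑ * ‖f‖ₑ) ^ 2 ≤ ∫⁻ x, ‖(x : ℝ)‖ₑ ^ 2 ∂(P.scalar f) := by
    have e : (‖(t : ℝ)‖ₑ * ‖f‖ₑ) ^ 2 = ∫⁻ _ in Set.Ici t, ‖(t : ℝ)‖ₑ ^ 2 ∂(P.scalar f) := by
      rw [setLIntegral_const, P.scalar_apply f measurableSet_Ici, hf, mul_pow,
        ENNReal.ofReal_pow (norm_nonneg _), ofReal_norm]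
    rw [e]
    refine (setLIntegral_mono (by fun_prop) fun x hx => pow_le_pow_left' ?_ 2).trans
      (lintegral_mono' Measure.restrict_le_self le_rfl)
    exact enorm_le_iff_norm_le.2 (by simpa using hx)
  rw [← P.enorm_sq_integral measurable_coe ⟨f, h⟩] at h1
  have h2 := (ENNReal.pow_le_pow_left_iff two_ne_zero).1 h1
  rw [← enorm_norm f, ← enorm_mul, enorm_le_iff_norm_le] at h2
  simpa using h2

theorem proj_proj (P : ProjMeasure ℝ≥0 H) {s : Set ℝ≥0} (hs : MeasurableSet s) (f : H) :
    P.proj s (P.proj s f) = P.proj s f := by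
  have := P.proj_inter s s hs hs
  rw [Set.inter_self] at this
  exact (congrArg (fun T : H →L[ℂ] H => T f) this).symm

theorem pow_bound {M : VonNeumannAlgebra H} (P : ProjMeasure ℝ≥0 H)
    (ha : IsAffiliated M (P.integral _ measurable_coe)) {y : H →L[ℂ] H} (hy : y ∈ M.commutant)
    (m t : ℝ≥0) (n : ℕ) : ∀ f, P.proj (Set.Iic m) f = f →
      (t : ℝ) ^ n * ‖P.proj (Set.Ici t) (y f)‖ ≤ ‖P.proj (Set.Ici t) * y‖ * (m : ℝ) ^ n * ‖f‖ := by
  induction n with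
  | zero => intro f _; simpa using (P.proj (Set.Ici t) * y).le_opNorm f
  | succ n ih =>
    intro f hf
    obtain ⟨hd, hb⟩ := P.mem_domain_of_Iic m hf
    obtain ⟨hyd, hya⟩ := ha y hy ⟨f, hd⟩
    have hb := hb hd
    set g := P.integral _ measurable_coe ⟨f, hd⟩ with hg
    have hgm : P.proj (Set.Iic m) g = g := by
      rw [hg, ← P.integral_proj measurable_coe measurableSet_Iic hd]
      congr 2
    have h1 := P.le_norm_of_Ici t (P.proj_proj measurableSet_Ici (y f))
      (P.proj_mem_domain measurable_coe measurableSet_Ici hyd)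
    rw [P.integral_proj measurable_coe measurableSet_Ici hyd, hya] at h1
    calc (t : ℝ) ^ (n + 1) * ‖P.proj (Set.Ici t) (y f)‖
        = (t : ℝ) ^ n * (t * ‖P.proj (Set.Ici t) (y f)‖) := by ring
      _ ≤ (t : ℝ) ^ n * ‖P.proj (Set.Ici t) (y g)‖ := by gcongr
      _ ≤ ‖P.proj (Set.Ici t) * y‖ * (m : ℝ) ^ n * ‖g‖ := ih g hgm
      _ ≤ ‖P.proj (Set.Ici t) * y‖ * (m : ℝ) ^ n * (m * ‖f‖) := by gcongr
      _ = _ := by ring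

theorem proj_Ici_eq_zero {M : VonNeumannAlgebra H} (P : ProjMeasure ℝ≥0 H)
    (ha : IsAffiliated M (P.integral _ measurable_coe)) {y : H →L[ℂ] H} (hy : y ∈ M.commutant)
    {m t : ℝ≥0} (hmt : m < t) {f : H} (hf : P.proj (Set.Iic m) f = f) :
    P.proj (Set.Ici t) (y f) = 0 := by
  have ht : (0 : ℝ) < t := lt_of_le_of_lt m.2 hmt
  have h1 : ∀ n : ℕ, ‖P.proj (Set.Ici t) (y f)‖
      ≤ ‖P.proj (Set.Ici t) * y‖ * ‖f‖ * ((m : ℝ) / t) ^ n := fun n => by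
    have := P.pow_bound ha hy m t n f hf
    rw [div_pow, mul_div_assoc', le_div_iff₀ (by positivity)]
    linarith
  have h2 : Tendsto (fun n : ℕ => ‖P.proj (Set.Ici t) * y‖ * ‖f‖ * ((m : ℝ) / t) ^ n) atTop
      (𝓝 (‖P.proj (Set.Ici t) * y‖ * ‖f‖ * 0)) :=
    (tendsto_pow_atTop_nhds_zero_of_lt_one (by positivity)
      ((div_lt_one ht).2 (by exact_mod_cast hmt))).const_mul _
  rw [mul_zero] at h2
  exact norm_le_zero_iff.1 (ge_of_tendsto h2 (Eventually.of_forall h1))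

theorem proj_Iic_apply {M : VonNeumannAlgebra H} (P : ProjMeasure ℝ≥0 H)
    (ha : IsAffiliated M (P.integral _ measurable_coe)) {y : H →L[ℂ] H} (hy : y ∈ M.commutant)
    (m : ℝ≥0) (f : H) :
    P.proj (Set.Iic m) (y (P.proj (Set.Iic m) f)) = y (P.proj (Set.Iic m) f) := by
  set g := y (P.proj (Set.Iic m) f)
  have h1 : P.scalar g (Set.Ioi m) = 0 := by
    have hu : Set.Ioi m = ⋃ n : ℕ, Set.Ici (m + 1 / ((n : ℝ≥0) + 1)) := by
      ext x
      simp only [Set.mem_Ioi, Set.mem_iUnion, Set.mem_Ici]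
      constructor
      · intro hx
        obtain ⟨n, hn⟩ := exists_nat_one_div_lt (sub_pos.2 (show (m : ℝ) < x by exact_mod_cast hx))
        refine ⟨n, ?_⟩
        rw [← NNReal.coe_le_coe]
        push_cast
        linarith
      · rintro ⟨n, hn⟩
        exact (lt_add_of_pos_right m (by positivity)).trans_le hn
    rw [hu]
    refine measure_iUnion_null fun n => ?_
    rw [P.scalar_apply _ measurableSet_Ici, P.proj_Ici_eq_zero ha hy
      (lt_add_of_pos_right m (by positivity)) (P.proj_proj measurableSet_Iic f)]
    simp
  rw [P.scalar_apply _ measurableSet_Ioi, ENNReal.ofReal_eq_zero] at h1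
  have h2 : P.proj (Set.Ioi m) g = 0 := by
    have := sq_nonneg ‖P.proj (Set.Ioi m) g‖
    simpa using le_antisymm h1 this
  have h3 := P.proj_union (measurableSet_Iic (a := m)) measurableSet_Ioi
    (Set.Iic_disjoint_Ioi le_rfl)
  rw [Set.Iic_union_Ioi, P.proj_univ] at h3
  have h4 := congrArg (fun T : H →L[ℂ] H => T g) h3
  simp only [add_apply, h2, add_zero] at h4
  exact h4.symm

/-- The spectral projections of an operator affiliated with `M` belong to `M`. -/
theorem _root_.IsAffiliated.proj_mem {M : VonNeumannAlgebra H} {a : H →ₗ.[ℂ] H}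
    (ha : IsAffiliated M a) {P : ProjMeasure ℝ≥0 H} (hP : P.integral _ measurable_coe = a)
    (s : Set ℝ≥0) (hs : MeasurableSet s) : P.proj s ∈ M := by
  subst hP
  have hI : ∀ m : ℝ≥0, P.proj (Set.Iic m) ∈ M := fun m => by
    refine mem_of_commute M fun y hy f => ?_
    have h1 := P.proj_Iic_apply ha hy m f
    rw [← h1]
    refine ext_inner_right ℂ fun g => ?_
    have hy' : star y ∈ M.commutant := star_mem hy
    have h2 := P.proj_Iic_apply ha hy' m g
    rw [P.inner_proj measurableSet_Iic, P.inner_proj measurableSet_Iic,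
      ← ContinuousLinearMap.adjoint_inner_right, ← ContinuousLinearMap.star_eq_adjoint,
      P.inner_proj measurableSet_Iic, h2, ContinuousLinearMap.star_eq_adjoint,
      ContinuousLinearMap.adjoint_inner_right]
  induction s, hs using MeasurableSpace.induction_on_inter
    (BorelSpace.measurable_eq.trans (borel_eq_generateFrom_Iic ℝ≥0)) isPiSystem_Iic with
  | empty => rw [P.proj_empty]; exact zero_mem M
  | basic t ht => obtain ⟨m, rfl⟩ := ht; exact hI m
  | compl t ht ih =>
    have h := P.proj_union ht ht.compl disjoint_compl_right
    rw [Set.union_compl_self, P.proj_univ] at h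
    rw [← sub_eq_of_eq_add' h]
    exact sub_mem (one_mem M) ih
  | iUnion f hd hm ih =>
    refine mem_of_commute M fun y hy g => ?_
    have h1 := y.hasSum (P.hasSum_iUnion f hm hd g)
    have h2 := P.hasSum_iUnion f hm hd (y g)
    refine h1.unique ?_
    simpa only [commute_of_mem M (ih _) y hy] using h2

/-- Bounded spectral integrals belong to `M` if the spectral projections do. -/
theorem bounded_mem {X : Type*} [MeasurableSpace X] {M : VonNeumannAlgebra H} {P : ProjMeasure X H}
    (hM : ∀ s, MeasurableSet s → P.proj s ∈ M) {ψ : X → ℝ} (hψ : Measurable ψ) {c : H →L[ℂ] H}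
    (hc : ∀ f, Tendsto (fun n => P.simpleIntegral (approx ψ hψ n) f) atTop (𝓝 (c f))) : c ∈ M := by
  refine mem_of_commute M fun y hy f => ?_
  refine tendsto_nhds_unique ((y.continuous.tendsto _).comp (hc f)) ?_
  refine (hc (y f)).congr fun n => ?_
  simp only [simpleIntegral, sum_apply, smul_apply, Function.comp_apply, map_sum]
  refine Finset.sum_congr rfl fun z _ => ?_
  rw [← commute_of_mem M (hM _ ((approx ψ hψ n).measurableSet_fiber z)) y hy,
    ← Complex.coe_smul, ← Complex.coe_smul, map_smul]

end ProjMeasure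

end Affiliated

/-- Boundedness of a partially defined operator on its domain. -/
def IsBoundedOperator {H : Type*} [NormedAddCommGroup H] [InnerProductSpace ℂ H]
    (T : H →ₗ.[ℂ] H) : Prop :=
  ∃ C : ℝ, ∀ f : T.domain, ‖T f‖ ≤ C * ‖(f : H)‖

/-- The exponents: positive real numbers. -/
abbrev PosReal : Type := {r : ℝ // 0 < r}

section OffDiagonal

variable {H : Type*} [NormedAddCommGroup H] [InnerProductSpace ℂ H] [CompleteSpace H]

/-- The sesquilinear form `(f, g) ↦ ⟨x b f, a g⟩` on `D(b) × D(a)` (Mathlib's inner product is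
conjugate linear in its first variable, so `⟨u, v⟩` is `inner ℂ v u`). -/
noncomputable def sesqForm (a b : H →ₗ.[ℂ] H) (x : H →L[ℂ] H) :
    b.domain →ₗ[ℂ] a.domain →ₗ⋆[ℂ] ℂ :=
  LinearMap.mk₂'ₛₗ (RingHom.id ℂ) (starRingEnd ℂ) (fun f g => inner ℂ (a g) (x (b f)))
    (by intros; simp [LinearPMap.map_add])
    (by intros; simp [LinearPMap.map_smul])
    (by intros; simp [LinearPMap.map_add])
    (by intros; simp [LinearPMap.map_smul, mul_comm])

/-- The function `t ↦ (t 1_{[0,1]}(t))^α`. -/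
noncomputable def lowFun (α : ℝ) (t : ℝ≥0) : ℝ := (if t ≤ 1 then (t : ℝ) else 0) ^ α

/-- The function `t ↦ (t 1_{(1,∞)}(t))^β`. -/
noncomputable def highFun (β : ℝ) (t : ℝ≥0) : ℝ := (if t ≤ 1 then 0 else (t : ℝ)) ^ β

theorem measurable_lowFun (α : ℝ) : Measurable (lowFun α) :=
  (Measurable.ite measurableSet_Iic (by fun_prop) (by fun_prop)).pow_const α

theorem measurable_highFun (β : ℝ) : Measurable (highFun β) :=
  (Measurable.ite measurableSet_Iic (by fun_prop) (by fun_prop)).pow_const β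

/-- `a₀ ^ α`, where `a₀ = ∫_{[0,1]} t dP` is the lower spectral part of `a = ∫ t dP`. -/
noncomputable def lowPow (P : ProjMeasure ℝ≥0 H) (α : PosReal) : H →ₗ.[ℂ] H :=
  P.integral (lowFun α) (measurable_lowFun α)

/-- `a_∞ ^ β`, where `a_∞ = ∫_{(1,∞)} t dP` is the upper spectral part of `a = ∫ t dP`. -/
noncomputable def highPow (P : ProjMeasure ℝ≥0 H) (β : PosReal) : H →ₗ.[ℂ] H :=
  P.integral (highFun β) (measurable_highFun β)

/-- `⋂_α D(a₀ ^ α)` (this is all of `H`, since `a₀` is bounded). -/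
noncomputable def lowCore (P : ProjMeasure ℝ≥0 H) : Submodule ℂ H :=
  ⨅ α : PosReal, (lowPow P α).domain

/-- `⋂_β D(a_∞ ^ β)`. It contains the ranges of all `P([0,n])`, hence it is a core for each
`a_∞ ^ β`. -/
noncomputable def highCore (P : ProjMeasure ℝ≥0 H) : Submodule ℂ H :=
  ⨅ β : PosReal, (highPow P β).domain

theorem lowCore_le (P : ProjMeasure ℝ≥0 H) (α : PosReal) : lowCore P ≤ (lowPow P α).domain :=
  iInf_le _ α

theorem highCore_le (P : ProjMeasure ℝ≥0 H) (β : PosReal) : highCore P ≤ (highPow P β).domain :=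
  iInf_le _ β

/-- The sesquilinear forms on the common core `⋂_β D(a_∞ ^ β) × ⋂_α D(a₀ ^ α)`. The forms
`a₀^α x a_∞^β` for different exponents have different domains; they are compared (and the
spaces that they form are included in each other) by restriction to this common core, where each
of them is determined by its values. -/
def CoreForm (P : ProjMeasure ℝ≥0 H) : Type _ :=
  highCore P →ₗ[ℂ] lowCore P →ₗ⋆[ℂ] ℂ

noncomputable instance (P : ProjMeasure ℝ≥0 H) : AddCommGroup (CoreForm P) :=
  inferInstanceAs (AddCommGroup (highCore P →ₗ[ℂ] lowCore P →ₗ⋆[ℂ] ℂ))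

noncomputable instance (P : ProjMeasure ℝ≥0 H) : Module ℂ (CoreForm P) :=
  inferInstanceAs (Module ℂ (highCore P →ₗ[ℂ] lowCore P →ₗ⋆[ℂ] ℂ))

instance (P : ProjMeasure ℝ≥0 H) : FunLike (CoreForm P) (highCore P) (lowCore P →ₗ⋆[ℂ] ℂ) :=
  inferInstanceAs
    (FunLike (highCore P →ₗ[ℂ] lowCore P →ₗ⋆[ℂ] ℂ) (highCore P) (lowCore P →ₗ⋆[ℂ] ℂ))

@[ext]
theorem CoreForm.ext {P : ProjMeasure ℝ≥0 H} {u v : CoreForm P} (h : ∀ f g, u f g = v f g) :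
    u = v := LinearMap.ext₂ h

@[simp]
theorem CoreForm.zero_apply (P : ProjMeasure ℝ≥0 H) (f : highCore P) (g : lowCore P) :
    (0 : CoreForm P) f g = 0 := rfl

@[simp]
theorem CoreForm.add_apply {P : ProjMeasure ℝ≥0 H} (u v : CoreForm P) (f : highCore P)
    (g : lowCore P) : (u + v) f g = u f g + v f g := rfl

@[simp]
theorem CoreForm.smul_apply {P : ProjMeasure ℝ≥0 H} (c : ℂ) (u : CoreForm P) (f : highCore P)
    (g : lowCore P) : (c • u) f g = c * u f g := rfl

/-- The form `a₀^α x a_∞^β`, restricted to the common core. -/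
noncomputable def coreForm (P : ProjMeasure ℝ≥0 H) (α β : PosReal) (x : H →L[ℂ] H) : CoreForm P :=
  LinearMap.mk₂'ₛₗ (RingHom.id ℂ) (starRingEnd ℂ)
    (fun f g => sesqForm (lowPow P α) (highPow P β) x
      (Submodule.inclusion (highCore_le P β) f) (Submodule.inclusion (lowCore_le P α) g))
    (by intros; simp only [map_add, LinearMap.add_apply])
    (by intros; simp only [map_smul, LinearMap.smul_apply, RingHom.id_apply])
    (by intros; simp only [map_add])
    (by intros; simp only [map_smul, map_smulₛₗ])

theorem coreForm_apply (P : ProjMeasure ℝ≥0 H) (α β : PosReal) (x : H →L[ℂ] H)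
    (f : highCore P) (g : lowCore P) : coreForm P α β x f g =
      inner ℂ (lowPow P α ⟨g, lowCore_le P α g.2⟩) (x (highPow P β ⟨f, highCore_le P β f.2⟩)) :=
  rfl

theorem coreForm_add (P : ProjMeasure ℝ≥0 H) (α β : PosReal) (x y : H →L[ℂ] H) :
    coreForm P α β (x + y) = coreForm P α β x + coreForm P α β y := by
  ext f g; simp [coreForm_apply]

theorem coreForm_smul (P : ProjMeasure ℝ≥0 H) (α β : PosReal) (c : ℂ) (x : H →L[ℂ] H) :
    coreForm P α β (c • x) = c • coreForm P α β x := by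
  ext f g; simp [coreForm_apply]

/-- The linear space `S^{α,β}` of the forms `a₀^α x a_∞^β` with `x ∈ M`. -/
noncomputable def formSpace (M : VonNeumannAlgebra H) (P : ProjMeasure ℝ≥0 H) (α β : PosReal) :
    Submodule ℂ (CoreForm P) where
  carrier := {u | ∃ x ∈ M, coreForm P α β x = u}
  zero_mem' := ⟨0, zero_mem M, by ext f g; simp [coreForm_apply]⟩
  add_mem' := by
    rintro _ _ ⟨x, hx, rfl⟩ ⟨y, hy, rfl⟩
    exact ⟨x + y, add_mem hx hy, coreForm_add P α β x y⟩
  smul_mem' := by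
    rintro c _ ⟨x, hx, rfl⟩
    exact ⟨c • x, M.toStarSubalgebra.smul_mem hx c, coreForm_smul P α β c x⟩

theorem formSpace_mono {M : VonNeumannAlgebra H} {P : ProjMeasure ℝ≥0 H}
    (hM : ∀ s, MeasurableSet s → P.proj s ∈ M) (α : PosReal) {β γ : PosReal} (h : β ≤ γ) :
    formSpace M P α β ≤ formSpace M P α γ := by
  rintro _ ⟨x, hx, rfl⟩
  have hψ : Measurable fun t : ℝ≥0 => if t ≤ 1 then (0 : ℝ) else (t : ℝ) ^ (β.1 - γ.1) :=
    Measurable.ite measurableSet_Iic (by fun_prop) (by fun_prop)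
  have h1 : ∀ t : ℝ≥0, ‖if t ≤ 1 then (0 : ℝ) else (t : ℝ) ^ (β.1 - γ.1)‖ ≤ 1 := fun t => by
    split_ifs with ht
    · simp
    · rw [Real.norm_of_nonneg (by positivity)]
      exact Real.rpow_le_one_of_one_le_of_nonpos (by exact_mod_cast (not_le.1 ht).le)
        (sub_nonpos.2 h)
  obtain ⟨c, hc⟩ := P.exists_bounded hψ h1
  refine ⟨x * c, mul_mem hx (ProjMeasure.bounded_mem hM hψ hc), ?_⟩
  ext f g
  rw [coreForm_apply, coreForm_apply]
  congr 1
  refine congrArg x (P.bounded_mul hψ (measurable_highFun γ) (measurable_highFun β) h1 ?_ hc _ _)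
  intro t
  unfold highFun
  split_ifs with ht
  · simp [Real.zero_rpow β.2.ne']
  · have : (0 : ℝ) < t := lt_trans one_pos (by exact_mod_cast not_le.1 ht)
    rw [← Real.rpow_add this]
    congr 1; ring

/-- The norm of `S^{α,β}`: the form `a₀^α x a_∞^β` has the norm `‖x‖`, where `x` is chosen of
least norm among the elements of `M` that give the same form (these agree with `x` in the corner
`p₀ x p_∞`; `a₀` and `a_∞` are not injective on `H`). -/
noncomputable def formNorm (M : VonNeumannAlgebra H) (P : ProjMeasure ℝ≥0 H) (α β : PosReal)
    (u : formSpace M P α β) : ℝ :=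
  sInf {r : ℝ | ∃ x ∈ M, coreForm P α β x = (u : CoreForm P) ∧ ‖x‖ = r}

theorem formNorm_le {M : VonNeumannAlgebra H} {P : ProjMeasure ℝ≥0 H} {α β : PosReal}
    {u : formSpace M P α β} {x : H →L[ℂ] H} (hx : x ∈ M)
    (hu : coreForm P α β x = (u : CoreForm P)) : formNorm M P α β u ≤ ‖x‖ :=
  csInf_le ⟨0, by rintro _ ⟨y, -, -, rfl⟩; exact norm_nonneg y⟩ ⟨x, hx, hu, rfl⟩

theorem exists_norm_lt {M : VonNeumannAlgebra H} {P : ProjMeasure ℝ≥0 H} {α β : PosReal}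
    (u : formSpace M P α β) {ε : ℝ} (hε : 0 < ε) :
    ∃ x ∈ M, coreForm P α β x = (u : CoreForm P) ∧ ‖x‖ < formNorm M P α β u + ε := by
  obtain ⟨x, hx, hu⟩ := u.2
  obtain ⟨_, ⟨y, hy, hyu, rfl⟩, h⟩ :=
    exists_lt_of_csInf_lt (s := {r : ℝ | ∃ x ∈ M, coreForm P α β x = (u : CoreForm P) ∧ ‖x‖ = r})
      ⟨_, x, hx, hu, rfl⟩ (lt_add_of_pos_right _ hε)
  exact ⟨y, hy, hyu, h⟩

/-- `S^{α,β}` as a normed group. -/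
noncomputable def formGroupNorm (M : VonNeumannAlgebra H) (P : ProjMeasure ℝ≥0 H)
    (α β : PosReal) : AddGroupNorm (formSpace M P α β) where
  toFun := formNorm M P α β
  map_zero' := by
    refine le_antisymm ?_ (Real.sInf_nonneg (by rintro _ ⟨y, -, -, rfl⟩; exact norm_nonneg y))
    simpa using formNorm_le (u := (0 : formSpace M P α β)) (zero_mem M)
      (by ext; simp [coreForm_apply])
  add_le' u v := by
    refine le_of_forall_pos_le_add fun ε hε => ?_
    obtain ⟨x, hx, hxu, hx'⟩ := exists_norm_lt u (half_pos hε)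
    obtain ⟨y, hy, hyv, hy'⟩ := exists_norm_lt v (half_pos hε)
    have h := formNorm_le (u := u + v) (add_mem hx hy) (by rw [coreForm_add, hxu, hyv]; rfl)
    linarith [norm_add_le x y]
  neg' u := by
    have key : ∀ w : formSpace M P α β, formNorm M P α β (-w) ≤ formNorm M P α β w := fun w => by
      refine le_of_forall_pos_le_add fun ε hε => ?_
      obtain ⟨x, hx, hxu, hx'⟩ := exists_norm_lt w hε
      have h := formNorm_le (u := -w) (neg_mem hx)
        (by rw [← neg_one_smul ℂ x, coreForm_smul, hxu]; exact neg_one_smul ℂ (w : CoreForm P))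
      rw [norm_neg] at h
      exact h.trans hx'.le
    exact le_antisymm (key u) ((congrArg _ (neg_neg u)).symm.trans_le (key (-u)))
  eq_zero_of_map_eq_zero' u hu := by
    ext f g
    set A := ‖lowPow P α ⟨g, lowCore_le P α g.2⟩‖
    set B := ‖highPow P β ⟨f, highCore_le P β f.2⟩‖
    have h1 : ∀ ε : ℝ, 0 < ε → ‖(u : CoreForm P) f g‖ ≤ A * (ε * B) := fun ε hε => by
      obtain ⟨x, -, hxu, hx'⟩ := exists_norm_lt u hε
      have hu' : formNorm M P α β u = 0 := hu
      rw [hu', zero_add] at hx'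
      rw [← hxu, coreForm_apply]
      refine (norm_inner_le_norm _ _).trans ?_
      gcongr
      exact (x.le_opNorm _).trans (by gcongr)
    have h2 : Tendsto (fun ε : ℝ => A * (ε * B)) (𝓝[>] 0) (𝓝 (A * (0 * B))) :=
      ((tendsto_id.mono_left nhdsWithin_le_nhds).mul_const B).const_mul A
    rw [zero_mul, mul_zero] at h2
    have h3 : ‖(u : CoreForm P) f g‖ ≤ 0 :=
      ge_of_tendsto h2 (by filter_upwards [self_mem_nhdsWithin] with ε hε using h1 ε hε)
    simpa using h3

/-- The topology `τ^{α,β}` of the norm of `S^{α,β}`. -/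
@[reducible] noncomputable def formTopology (M : VonNeumannAlgebra H) (P : ProjMeasure ℝ≥0 H)
    (α β : PosReal) : TopologicalSpace (formSpace M P α β) :=
  (formGroupNorm M P α β).toNormedAddCommGroup.toPseudoMetricSpace.toUniformSpace.toTopologicalSpace

/-- The two usual meanings of the strongest topology in the definition of an inductive limit:
among all topologies, or among all locally convex vector space topologies. -/
inductive LimitKind
  | topological
  | locallyConvex

/-- The topologies on `E` among which the strongest one is taken. -/
def LimitKind.Admits (k : LimitKind) {E : Type*} [AddCommGroup E] [Module ℂ E]
    (t : TopologicalSpace E) : Prop :=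
  match k with
  | .topological => True
  | .locallyConvex => IsTopologicalAddGroup E ∧ ContinuousSMul ℂ E ∧ LocallyConvexSpace ℝ E

/-- The strongest (in the sense of `k`) topology on `E` such that all `m i : F i → E` are
continuous. In the order of Mathlib a stronger topology is smaller. -/
@[reducible] def finalTopology (k : LimitKind) {E : Type*} [AddCommGroup E] [Module ℂ E] {ι : Type*}
    {F : ι → Type*} (τ : ∀ i, TopologicalSpace (F i)) (m : ∀ i, F i → E) : TopologicalSpace E :=
  sInf {t | k.Admits t ∧ ∀ i, Continuous[τ i, t] (m i)}

/-- The weakest topology on `E` such that all `m i : E → F i` are continuous. -/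
@[reducible] def initialTopology {E : Type*} {ι : Type*} {F : ι → Type*}
    (τ : ∀ i, TopologicalSpace (F i)) (m : ∀ i, E → F i) : TopologicalSpace E :=
  ⨅ i, (τ i).induced (m i)

variable {M : VonNeumannAlgebra H} {P : ProjMeasure ℝ≥0 H}

/-- `𝔖_0^α = ⋃_β S^{α,β}`. -/
noncomputable def unionSpace (hM : ∀ s, MeasurableSet s → P.proj s ∈ M) (α : PosReal) :
    Submodule ℂ (CoreForm P) where
  carrier := ⋃ β : PosReal, (formSpace M P α β : Set (CoreForm P))
  zero_mem' := Set.mem_iUnion.2 ⟨⟨1, one_pos⟩, zero_mem _⟩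
  add_mem' := by
    intro u v hu hv
    obtain ⟨β, hβ⟩ := Set.mem_iUnion.1 hu
    obtain ⟨γ, hγ⟩ := Set.mem_iUnion.1 hv
    exact Set.mem_iUnion.2 ⟨max β γ, add_mem (formSpace_mono hM α (le_max_left β γ) hβ)
      (formSpace_mono hM α (le_max_right β γ) hγ)⟩
  smul_mem' := by
    intro c u hu
    obtain ⟨β, hβ⟩ := Set.mem_iUnion.1 hu
    exact Set.mem_iUnion.2 ⟨β, Submodule.smul_mem _ c hβ⟩

theorem formSpace_le_unionSpace (hM : ∀ s, MeasurableSet s → P.proj s ∈ M) (α β : PosReal) :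
    formSpace M P α β ≤ unionSpace hM α := fun _ hu => Set.mem_iUnion.2 ⟨β, hu⟩

/-- `𝔖_∞^β = ⋂_α S^{α,β}`. -/
noncomputable def interSpace (M : VonNeumannAlgebra H) (P : ProjMeasure ℝ≥0 H) (β : PosReal) :
    Submodule ℂ (CoreForm P) :=
  ⨅ α : PosReal, formSpace M P α β

theorem interSpace_le_formSpace (M : VonNeumannAlgebra H) (P : ProjMeasure ℝ≥0 H)
    (α β : PosReal) : interSpace M P β ≤ formSpace M P α β := iInf_le _ α

theorem interSpace_mono (hM : ∀ s, MeasurableSet s → P.proj s ∈ M) {β γ : PosReal} (h : β ≤ γ) :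
    interSpace M P β ≤ interSpace M P γ :=
  iInf_mono fun α => formSpace_mono hM α h

/-- The inductive limit topology `τ_0^α` of `𝔖_0^α`. -/
@[reducible] noncomputable def unionTopology (k : LimitKind) (hM : ∀ s, MeasurableSet s → P.proj s ∈ M)
    (α : PosReal) : TopologicalSpace (unionSpace hM α) :=
  finalTopology k (fun β => formTopology M P α β)
    fun β => Submodule.inclusion (formSpace_le_unionSpace hM α β)

/-- The projective limit topology `τ_∞^β` of `𝔖_∞^β`. -/
@[reducible] noncomputable def interTopology (M : VonNeumannAlgebra H) (P : ProjMeasure ℝ≥0 H)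
    (β : PosReal) : TopologicalSpace (interSpace M P β) :=
  initialTopology (fun α => formTopology M P α β)
    fun α => Submodule.inclusion (interSpace_le_formSpace M P α β)

/-- The upper space `⋂_α 𝔖_0^α = ⋂_α ⋃_β S^{α,β}`. -/
noncomputable def upperLimit (hM : ∀ s, MeasurableSet s → P.proj s ∈ M) :
    Submodule ℂ (CoreForm P) :=
  ⨅ α : PosReal, unionSpace hM α

/-- The lower space `⋃_β 𝔖_∞^β = ⋃_β ⋂_α S^{α,β}`. -/
noncomputable def lowerLimit (hM : ∀ s, MeasurableSet s → P.proj s ∈ M) :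
    Submodule ℂ (CoreForm P) where
  carrier := ⋃ β : PosReal, (interSpace M P β : Set (CoreForm P))
  zero_mem' := Set.mem_iUnion.2 ⟨⟨1, one_pos⟩, zero_mem _⟩
  add_mem' := by
    intro u v hu hv
    obtain ⟨β, hβ⟩ := Set.mem_iUnion.1 hu
    obtain ⟨γ, hγ⟩ := Set.mem_iUnion.1 hv
    exact Set.mem_iUnion.2 ⟨max β γ, add_mem (interSpace_mono hM (le_max_left β γ) hβ)
      (interSpace_mono hM (le_max_right β γ) hγ)⟩
  smul_mem' := by
    intro c u hu
    obtain ⟨β, hβ⟩ := Set.mem_iUnion.1 hu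
    exact Set.mem_iUnion.2 ⟨β, Submodule.smul_mem _ c hβ⟩

theorem interSpace_le_lowerLimit (hM : ∀ s, MeasurableSet s → P.proj s ∈ M) (β : PosReal) :
    interSpace M P β ≤ lowerLimit hM := fun _ hu => Set.mem_iUnion.2 ⟨β, hu⟩

theorem upperLimit_le_unionSpace (hM : ∀ s, MeasurableSet s → P.proj s ∈ M) (α : PosReal) :
    upperLimit hM ≤ unionSpace hM α := iInf_le _ α

/-- The topology of the lower space: the strongest one for which the embeddings
`𝔖_∞^β → ⋃_β 𝔖_∞^β` are continuous. -/
@[reducible] noncomputable def lowerLimitTopology (k : LimitKind)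
    (hM : ∀ s, MeasurableSet s → P.proj s ∈ M) : TopologicalSpace (lowerLimit hM) :=
  finalTopology k (fun β => interTopology M P β)
    fun β => Submodule.inclusion (interSpace_le_lowerLimit hM β)

/-- The topology of the upper space: the weakest one for which the embeddings
`⋂_α 𝔖_0^α → 𝔖_0^α` are continuous. -/
@[reducible] noncomputable def upperLimitTopology (k : LimitKind)
    (hM : ∀ s, MeasurableSet s → P.proj s ∈ M) : TopologicalSpace (upperLimit hM) :=
  initialTopology (fun α => unionTopology k hM α)
    fun α => Submodule.inclusion (upperLimit_le_unionSpace hM α)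

end OffDiagonal

/-! The inclusion is the exchange of a union and an intersection. A form in the lower space lies in
$\bigcap_\alpha \mathcal S^{\alpha,\beta}$ for one $\beta$, and this same $\beta$ serves every
$\alpha$, so the form lies in each $\mathfrak S_0^\alpha$.

Continuity follows from the universal properties of the two limits and needs no norm estimate. A
linear map out of the inductive limit over $\beta$ can be tested on each $\mathfrak S_\infty^\beta$
(`continuous_from_finalTopology`). A map into the projective limit over $\alpha$ can be tested after
the embedding into each $\mathfrak S_0^\alpha$ (`continuous_to_initialTopology`). For fixed $\alpha$
and $\beta$ what is left is the embedding $\mathfrak S_\infty^\beta\to\mathfrak S_0^\alpha$. It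
factors as $\mathfrak S_\infty^\beta\to\mathcal S^{\alpha,\beta}\to\mathfrak S_0^\alpha$, and the
two factors are continuous by the definitions of $\tau_\infty^\beta$ and $\tau_0^\alpha$.

The delicate point is the locally convex reading of "strongest". There the test on the pieces is
valid only if the target topology is itself a locally convex vector space topology. The target is a
projective limit of inductive limits, so it suffices that admissible topologies are stable under
infima in Mathlib's order (`LimitKind.Admits.sInf`) and under pullback along linear maps
(`LimitKind.Admits.induced`). With these two facts one argument covers both readings. -/

/-! ### Stability of the admissible class of topologies -/

namespace LimitKind

variable {E F : Type*} [AddCommGroup E] [Module ℂ E] [AddCommGroup F] [Module ℂ F]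

/-- In Mathlib's order `sInf T` is the topology generated by all members of `T` together, that is,
the weakest one stronger than each of them. Finite intersections of convex neighbourhoods are
convex, and the vector operations are continuous because they are so for each member. Hence the
class of competitors in `finalTopology` has an actual strongest element. -/
theorem Admits.sInf (k : LimitKind) {T : Set (TopologicalSpace E)} (hT : ∀ t ∈ T, k.Admits t) :
    k.Admits (sInf T) := by
  cases k with
  | topological => trivial
  | locallyConvex =>
    exact ⟨topologicalAddGroup_sInf fun t ht => (hT t ht).1,
      continuousSMul_sInf fun t ht => (hT t ht).2.1,
      LocallyConvexSpace.sInf fun t ht => (hT t ht).2.2⟩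

theorem Admits.iInf (k : LimitKind) {ι : Type*} {t : ι → TopologicalSpace E}
    (ht : ∀ i, k.Admits (t i)) : k.Admits (⨅ i, t i) :=
  Admits.sInf k (Set.forall_mem_range.2 ht)

/-- A linear map commutes with the vector operations, and preimages of convex sets under it are
convex. -/
theorem Admits.induced (k : LimitKind) {t : TopologicalSpace F} (ht : k.Admits t)
    (m : E →ₗ[ℂ] F) : k.Admits (t.induced m) := by
  cases k with
  | topological => trivial
  | locallyConvex =>
    obtain ⟨_, _, _⟩ := ht
    exact ⟨topologicalAddGroup_induced m, continuousSMul_induced m,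
      -- Convexity is a notion over `ℝ`, whereas `m` is linear over `ℂ`.
      LocallyConvexSpace.induced (m.restrictScalars ℝ)⟩

end LimitKind

/-! ### Universal properties of final and initial topologies -/

section FinalTopology

variable {E : Type*} [AddCommGroup E] [Module ℂ E] {ι : Type*} {F : ι → Type*}
  (k : LimitKind) (τ : ∀ i, TopologicalSpace (F i)) (m : ∀ i, F i → E)

theorem admits_finalTopology : k.Admits (finalTopology k τ m) :=
  LimitKind.Admits.sInf k fun _ ht => ht.1

/-- Each `m i` is continuous for every competing topology, hence for the one they generate together.
With `admits_finalTopology` this shows that the infimum is attained: the final topology is one of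
its own competitors. -/
theorem continuous_to_finalTopology (i : ι) : Continuous[τ i, finalTopology k τ m] (m i) := by
  let := τ i
  exact continuous_sInf_rng.2 fun _ ht => ht.2 i

/-- The universal property of the final topology, for linear maps. -/
theorem continuous_from_finalTopology {G : Type*} [AddCommGroup G] [Module ℂ G]
    {t : TopologicalSpace G} (ht : k.Admits t) (L : E →ₗ[ℂ] G)
    (hL : ∀ i, Continuous[τ i, t] (L ∘ m i)) : Continuous[finalTopology k τ m, t] L := by
  rw [continuous_iff_le_induced]
  -- The pullback of `t` along `L` is one of the topologies competing in the definition of the final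
  -- topology, so the final topology is at least as strong. Both `ht` and the linearity of `L` serve
  -- to make this pullback admissible.
  refine sInf_le ⟨LimitKind.Admits.induced k ht L, fun i => ?_⟩
  let := τ i
  exact continuous_induced_rng.2 (hL i)

theorem continuous_from_initialTopology {E : Type*} {F : ι → Type*}
    (τ : ∀ i, TopologicalSpace (F i)) (m : ∀ i, E → F i) (i : ι) :
    Continuous[initialTopology τ m, τ i] (m i) := by
  let := τ i
  exact continuous_iInf_dom (i := i) continuous_induced_dom

theorem continuous_to_initialTopology {E X : Type*} {F : ι → Type*} [TopologicalSpace X]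
    (τ : ∀ i, TopologicalSpace (F i)) (m : ∀ i, E → F i) {f : X → E}
    (hf : ∀ i, Continuous[_, τ i] (m i ∘ f)) : Continuous[_, initialTopology τ m] f :=
  continuous_iInf_rng.2 fun i => by
    let := τ i
    exact continuous_induced_rng.2 (hf i)

end FinalTopology

/-! ### The embedding of the lower space into the upper space -/

section LimitSpaces

variable {H : Type*} [NormedAddCommGroup H] [InnerProductSpace ℂ H] [CompleteSpace H]
  {M : VonNeumannAlgebra H} {P : ProjMeasure ℝ≥0 H}

theorem lowerLimit_le_upperLimit (hM : ∀ s, MeasurableSet s → P.proj s ∈ M) :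
    lowerLimit hM ≤ upperLimit hM := by
  refine le_iInf fun α u hu => ?_
  obtain ⟨β, hβ⟩ := Set.mem_iUnion.1 hu
  -- The index `β` supplied by the lower space is a valid witness for the union at every `α`.
  exact formSpace_le_unionSpace hM α β (interSpace_le_formSpace M P α β hβ)

/-- An infimum of pullbacks, along linear inclusions, of the admissible topologies $\tau_0^\alpha$.
This is the condition on the target under which continuity may be tested on the pieces $\mathfrak
S_\infty^\beta$. -/
theorem admits_upperLimitTopology (k : LimitKind) (hM : ∀ s, MeasurableSet s → P.proj s ∈ M) :
    k.Admits (upperLimitTopology k hM) :=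
  LimitKind.Admits.iInf k fun _ => LimitKind.Admits.induced k (admits_finalTopology k _ _) _

theorem continuous_inclusion_lowerLimit (k : LimitKind)
    (hM : ∀ s, MeasurableSet s → P.proj s ∈ M) :
    Continuous[lowerLimitTopology k hM, upperLimitTopology k hM]
      (Submodule.inclusion (lowerLimit_le_upperLimit hM)) := by
  -- Reduction to one piece $\mathfrak S_\infty^\beta$ of the source; the projective limit in the
  -- target is then resolved into single exponents `α`.
  refine continuous_from_finalTopology k _ _ (admits_upperLimitTopology k hM) _ fun β => ?_
  let := interTopology M P β
  refine continuous_to_initialTopology _ _ fun α => ?_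
  let := formTopology M P α β
  let := unionTopology k hM α
  have h1 : Continuous (Submodule.inclusion (formSpace_le_unionSpace hM α β)) :=
    continuous_to_finalTopology k (fun β => formTopology M P α β)
      (fun β => Submodule.inclusion (formSpace_le_unionSpace hM α β)) β
  have h2 : Continuous (Submodule.inclusion (interSpace_le_formSpace M P α β)) :=
    continuous_from_initialTopology (fun α => formTopology M P α β)
      (fun α => Submodule.inclusion (interSpace_le_formSpace M P α β)) α
  -- The goal is the composite through the lower and upper spaces, while `h1.comp h2` passes through
  -- $\mathcal S^{\alpha,\beta}$. Both leave the underlying form unchanged and differ only in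
  -- membership proofs, so they agree definitionally.
  exact h1.comp h2

end LimitSpaces

/-- Affiliation enters through `IsAffiliated.proj_mem`: the spectral projections lie in `M`, hence
so do the bounded spectral integrals that raise the exponent of $a_\infty$. The spaces are therefore
nested in `β`, and their unions are linear spaces. -/
theorem theorem2 {H : Type*} [NormedAddCommGroup H] [InnerProductSpace ℂ H] [CompleteSpace H]
    (M : VonNeumannAlgebra H) (a : H →ₗ.[ℂ] H) (ha : IsSelfAdjoint a)
    (hpos : ∀ f : a.domain, 0 ≤ RCLike.re (inner ℂ (f : H) (a f)))
    (haM : IsAffiliated M a) (hinj : Function.Injective a)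
    (hunb : ¬ IsBoundedOperator a) (hunb' : ¬ IsBoundedOperator a.inverse)
    (P : ProjMeasure ℝ≥0 H) (hP : P.integral (fun t => (t : ℝ)) ProjMeasure.measurable_coe = a)
    (k : LimitKind) :
    ∃ h : lowerLimit (haM.proj_mem hP) ≤ upperLimit (haM.proj_mem hP),
      Continuous[lowerLimitTopology k (haM.proj_mem hP), upperLimitTopology k (haM.proj_mem hP)]
        (Submodule.inclusion h) :=
  ⟨lowerLimit_le_upperLimit _, continuous_inclusion_lowerLimit k _⟩
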